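/- Let $L$ be a countable language (relation, function and constant symbols allowed). Structures are non-empty, "countable" means finite or countably infinite, and $\mathcal L_{\omega_1,\omega}(L)$ is the usual infinitary logic, with countable conjunctions and disjunctions, formulas having only finitely many free variables. A sentence is *pithy $\Pi_2$* if it has the form $(\forall\mathbf x)(\exists y)\,\psi(\mathbf x,y)$ with $\psi$ a quantifier-free formula of $\mathcal L_{\omega_1,\omega}(L)$, $\mathbf x$ a finite (possibly empty) tuple of variables and $y$ a single variable. A *quantifier-free type* $p(\mathbf x)$ is a quantifier-free formula of $\mathcal L_{\omega_1,\omega}(L)$ whose free variables are precisely those of the finite tuple $\mathbf x$, such that $(\exists\mathbf x)p(\mathbf x)$ has a model and such that for every quantifier-free formula $\varphi(\mathbf x)$ of $\mathcal L_{\omega_1,\omega}(L)$ either $\models p(\mathbf x)\to\varphi(\mathbf x)$ or $\models p(\mathbf x)\to\neg\varphi(\mathbf x)$. It is *non-redundant* if it implies that the variables in $\mathbf x$ are pairwise distinct, and *consistent with* a theory $T$ if $T\cup\{(\exists\mathbf x)p(\mathbf x)\}$ has a model. A theory $T$ *has duplication of quantifier-free types* if for every non-redundant quantifier-free type $p(x,\mathbf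 z)$ consistent with $T$ (with $\mathbf z$ a finite, possibly empty, tuple) there is a non-redundant quantifier-free type $q(x,y,\mathbf z)$ consistent with $T$ such that $\models q(x,y,\mathbf z)\to\bigl(p(x,\mathbf z)\wedge p(y,\mathbf z)\bigr)$. An $L$-structure $\mathcal M$ *has trivial definable closure* if for every finite (possibly empty) tuple $\mathbf a$ of elements of $\mathcal M$, the only elements of $\mathcal M$ that are fixed by all automorphisms of $\mathcal M$ fixing $\mathbf a$ pointwise are the entries of $\mathbf a$. **Statement.** Let $T$ be a countable set of pithy $\Pi_2$ sentences of $\mathcal L_{\omega_1,\omega}(L)$ that has, up to isomorphism, exactly one countable model $\mathcal M$. Then $\mathcal M$ has trivial definable closure if and only if $T$ has duplication of quantifier-free types. -/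

import Mathlib

universe u v w

namespace Infinitary

/-- Formulas of `ℒ_{ω₁,ω}(L)` whose free variables are among `x₀, …, xₙ₋₁`: equations and relations
between terms, negations, conjunctions over countable (possibly empty or finite) index sets, and
existential quantification. As with Mathlib's bounded formulas, bound variables are de Bruijn
levels: `ex φ` is `∃ xₙ, φ(x₀, …, xₙ)`. Every formula has only finitely many free variables. -/
inductive Form (L : FirstOrder.Language.{u, v}) : ℕ → Type (max u v)
  | equal {n : ℕ} (s t : L.Term (Fin n)) : Form L n
  | rel {n l : ℕ} (R : L.Relations l) (ts : Fin l → L.Term (Fin n)) : Form L n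
  | neg {n : ℕ} (φ : Form L n) : Form L n
  | conj {n : ℕ} (I : Set ℕ) (φ : I → Form L n) : Form L n
  | ex {n : ℕ} (φ : Form L (n + 1)) : Form L n

/-- Sentences of `ℒ_{ω₁,ω}(L)`. A theory is a set of sentences. -/
abbrev Sentence (L : FirstOrder.Language.{u, v}) : Type (max u v) := Form L 0

namespace Form

variable {L : FirstOrder.Language.{u, v}}

/-- `M ⊨ φ(a₀, …, aₙ₋₁)`. -/
def Realize {M : Type w} [L.Structure M] : {n : ℕ} → Form L n → (Fin n → M) → Prop
  | _, equal s t, a => s.realize a = t.realize a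
  | _, rel R ts, a => FirstOrder.Language.Structure.RelMap R fun i => (ts i).realize a
  | _, neg φ, a => ¬ φ.Realize a
  | _, conj _ φ, a => ∀ i, (φ i).Realize a
  | _, ex φ, a => ∃ b : M, φ.Realize (Fin.snoc a b)

/-- No quantifier occurs in the formula. -/
def IsQF : {n : ℕ} → Form L n → Prop
  | _, equal _ _ => True
  | _, rel _ _ => True
  | _, neg φ => φ.IsQF
  | _, conj _ φ => ∀ i, (φ i).IsQF
  | _, ex _ => False

/-- The (indices of the) variables that occur free in the formula. -/
def freeVars : {n : ℕ} → Form L n → Set (Fin n)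
  | _, equal s t => {i | i ∈ s.varFinset ∨ i ∈ t.varFinset}
  | _, rel _ ts => {i | ∃ j, i ∈ (ts j).varFinset}
  | _, neg φ => φ.freeVars
  | _, conj _ φ => {i | ∃ j, i ∈ (φ j).freeVars}
  | _, ex φ => {i | i.castSucc ∈ φ.freeVars}

/-- `∀ xₙ, φ`, that is, `¬ ∃ xₙ, ¬ φ`. -/
def all {n : ℕ} (φ : Form L (n + 1)) : Form L n := neg (ex (neg φ))

/-- The sentence `∀ x₀ ⋯ xₙ₋₁, φ`. -/
def alls : {n : ℕ} → Form L n → Sentence L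
  | 0, φ => φ
  | _ + 1, φ => φ.all.alls

/-- The equation `xᵢ = xⱼ`. -/
def varEq {n : ℕ} (i j : Fin n) : Form L n :=
  equal (FirstOrder.Language.Term.var i) (FirstOrder.Language.Term.var j)

/-- `⊨ φ(𝐱) → ψ(𝐱)`: the implication holds at all tuples of all (non-empty) structures. -/
def Implies {n : ℕ} (φ ψ : Form L n) : Prop :=
  ∀ (M : Type w) [L.Structure M] [Nonempty M] (a : Fin n → M), φ.Realize a → ψ.Realize a

end Form

variable {L : FirstOrder.Language.{u, v}}

/-- A pithy `Π₂` sentence: `(∀ 𝐱)(∃ y) ψ(𝐱, y)` with `ψ` quantifier-free, `𝐱` a finite and possibly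
empty tuple, and `y` a single variable. -/
def IsPithyPiTwo (φ : Sentence L) : Prop :=
  ∃ (k : ℕ) (ψ : Form L (k + 1)), ψ.IsQF ∧ φ = ψ.ex.alls

/-- `M` is a model of the theory `T`. -/
def Models (M : Type w) [L.Structure M] (T : Set (Sentence L)) : Prop :=
  ∀ φ ∈ T, φ.Realize (default : Fin 0 → M)

/-- `T ∪ {(∃ 𝐱) p(𝐱)}` has a model. -/
def ConsistentWith {n : ℕ} (p : Form L n) (T : Set (Sentence L)) : Prop :=
  ∃ (M : Type w) (_ : L.Structure M) (_ : Nonempty M), Models M T ∧ ∃ a : Fin n → M, p.Realize a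

/-- Complete quantifier-free types `p(x₀, …, xₙ₋₁)` of `ℒ_{ω₁,ω}(L)`, as single formulas. -/
structure IsQFType {n : ℕ} (p : Form L n) : Prop where
  isQF : p.IsQF
  freeVars_eq : p.freeVars = Set.univ
  satisfiable : ConsistentWith.{u, v, w} p ∅
  complete : ∀ φ : Form L n, φ.IsQF → Form.Implies.{u, v, w} p φ ∨ Form.Implies.{u, v, w} p φ.neg

/-- `p` implies that its variables are pairwise distinct. -/
def NonRedundant {n : ℕ} (p : Form L n) : Prop :=
  ∀ i j : Fin n, i < j → Form.Implies.{u, v, w} p (Form.varEq i j).neg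

/-- Duplication of quantifier-free types: each non-redundant quantifier-free type `p(x, 𝐳)` consistent
with `T` admits a non-redundant quantifier-free type `q(x, y, 𝐳)` consistent with `T` such that
`⊨ q(x, y, 𝐳) → p(x, 𝐳) ∧ p(y, 𝐳)`. The first variable of `p` is `x`, the first two of `q` are
`x` and `y`, and the remaining ones form the (possibly empty) tuple `𝐳`. -/
def HasDuplication (T : Set (Sentence L)) : Prop :=
  ∀ (k : ℕ) (p : Form L (k + 1)),
    IsQFType.{u, v, w} p → NonRedundant.{u, v, w} p → ConsistentWith.{u, v, w} p T →
    ∃ q : Form L (k + 2),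
      IsQFType.{u, v, w} q ∧ NonRedundant.{u, v, w} q ∧ ConsistentWith.{u, v, w} q T ∧
      ∀ (M : Type w) [L.Structure M] [Nonempty M] (a b : M) (c : Fin k → M),
        q.Realize (Fin.cons a (Fin.cons b c) : Fin (k + 2) → M) →
          p.Realize (Fin.cons a c : Fin (k + 1) → M) ∧ p.Realize (Fin.cons b c : Fin (k + 1) → M)

/-- The (group-theoretic) definable closure of the tuple `a` in `M`: the elements fixed by every
automorphism of `M` that fixes `a` pointwise. -/
def dcl (L : FirstOrder.Language.{u, v}) {M : Type w} [L.Structure M] {n : ℕ} (a : Fin n → M) : Set M :=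
  {b | ∀ g : L.Equiv M M, (∀ i, g (a i) = a i) → g b = b}

/-- The definable closure of every finite tuple consists of the entries of the tuple only. -/
def HasTrivialDcl (L : FirstOrder.Language.{u, v}) (M : Type w) [L.Structure M] : Prop :=
  ∀ (n : ℕ) (a : Fin n → M), dcl L a = Set.range a

end Infinitary

/-! From trivial definable closure to duplication: every quantifier-free type consistent with `T` is
realized in `M` (`exists_atomAgree_of_unique`), so `p` holds at some `(b, z)` with `b` not in `z`.
Some automorphism `g` fixes `z` and moves `b`, and the quantifier-free type of `(b, g b, z)` serves
as `q`.

For the converse, suppose that `b ∈ dcl L a` is not an entry of `a`. One formula `φ` defines the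
orbit of `(a, b)` (`exists_orbit_formula`). Finite assignments of elements of `M` to variables,
ordered by extension of quantifier-free types, form a forcing whose sufficiently generic limits are
countable models of `T` (`exists_model_limit`), hence copies of `M`. So some condition `p` forces
`φ` (`exists_forcing`). Duplication puts two copies of `p` into one condition, with equal values for
`a` and different values for `b` (`HasDuplication.exists_cond`). A generic model above it has two
tuples in the orbit of `(a, b)` that agree on `a` and differ at `b`, against `b ∈ dcl L a`. -/

namespace Infinitary

open FirstOrder FirstOrder.Language

/-! ### Atomic agreement and quantifier-free types -/

section Basic

variable {L : FirstOrder.Language.{u, v}}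

/-- The tuples `a` and `b`, of possibly different structures, satisfy the same atomic formulas. -/
structure AtomAgree (L : FirstOrder.Language.{u, v}) {M N α : Type*} [L.Structure M]
    [L.Structure N] (a : α → M) (b : α → N) : Prop where
  equal : ∀ s t : L.Term α, s.realize a = t.realize a ↔ s.realize b = t.realize b
  rel : ∀ (l : ℕ) (R : L.Relations l) (ts : Fin l → L.Term α),
    Structure.RelMap R (fun i => (ts i).realize a) ↔ Structure.RelMap R (fun i => (ts i).realize b)

namespace AtomAgree

variable {M N P α β : Type*} [L.Structure M] [L.Structure N] [L.Structure P]
  {a : α → M} {b : α → N} {c : α → P}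

theorem refl (a : α → M) : AtomAgree L a a := ⟨fun _ _ => Iff.rfl, fun _ _ _ => Iff.rfl⟩

theorem symm (h : AtomAgree L a b) : AtomAgree L b a :=
  ⟨fun s t => (h.equal s t).symm, fun l R ts => (h.rel l R ts).symm⟩

theorem trans (h : AtomAgree L a b) (h' : AtomAgree L b c) : AtomAgree L a c :=
  ⟨fun s t => (h.equal s t).trans (h'.equal s t),
    fun l R ts => (h.rel l R ts).trans (h'.rel l R ts)⟩

theorem comp (h : AtomAgree L a b) (f : β → α) : AtomAgree L (a ∘ f) (b ∘ f) := by
  refine ⟨fun s t => ?_, fun l R ts => ?_⟩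
  · simpa only [Term.realize_relabel] using h.equal (s.relabel f) (t.relabel f)
  · simpa only [Term.realize_relabel] using h.rel l R fun i => (ts i).relabel f

theorem eq_iff (h : AtomAgree L a b) (i j : α) : a i = a j ↔ b i = b j :=
  h.equal (Term.var i) (Term.var j)

theorem realize_iff {n : ℕ} {a : Fin n → M} {b : Fin n → N} (h : AtomAgree L a b) {φ : Form L n}
    (hφ : φ.IsQF) : φ.Realize a ↔ φ.Realize b := by
  induction φ with
  | equal s t => exact h.equal s t
  | rel R ts => exact h.rel _ R ts
  | neg φ ih => exact not_congr (ih h hφ)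
  | conj I φ ih => exact forall_congr' fun i => ih i h (hφ i)
  | ex φ => exact hφ.elim

theorem of_equiv (g : L.Equiv M N) (a : α → M) : AtomAgree L a (g ∘ a) := by
  refine ⟨fun s t => ?_, fun l R ts => ?_⟩
  · simp only [HomClass.realize_term, g.injective.eq_iff]
  · simp only [HomClass.realize_term]
    exact (StrongHomClass.map_rel g R _).symm

end AtomAgree

namespace Form

theorem realize_equiv {M N : Type*} [L.Structure M] [L.Structure N] (g : L.Equiv M N) {n : ℕ}
    (φ : Form L n) (a : Fin n → M) : φ.Realize (g ∘ a) ↔ φ.Realize a := by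
  induction φ with
  | equal s t => exact ((AtomAgree.of_equiv g a).equal s t).symm
  | rel R ts => exact ((AtomAgree.of_equiv g a).rel _ R ts).symm
  | neg φ ih => exact not_congr (ih a)
  | conj I φ ih => exact forall_congr' fun i => ih i a
  | ex φ ih =>
    refine ⟨fun ⟨b, hb⟩ => ⟨g.symm b, (ih _).1 ?_⟩, fun ⟨b, hb⟩ => ⟨g b, ?_⟩⟩
    · rw [Fin.comp_snoc, FirstOrder.Language.Equiv.apply_symm_apply]
      exact hb
    · rw [← Fin.comp_snoc]
      exact (ih _).2 hb

theorem realize_alls {M : Type*} [L.Structure M] {n : ℕ} (φ : Form L n) :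
    φ.alls.Realize (default : Fin 0 → M) ↔ ∀ a : Fin n → M, φ.Realize a := by
  induction n with
  | zero =>
    rw [alls]
    exact ⟨fun h a => by rwa [Subsingleton.elim a default], fun h => h _⟩
  | succ n ih =>
    rw [alls, ih]
    simp only [all, Realize, not_exists, not_not]
    refine ⟨fun h a => ?_, fun h a b => h _⟩
    rw [← Fin.snoc_init_self a]
    exact h _ _

open Classical in
/-- The conjunction of a family of formulas indexed by a countable type. -/
noncomputable def conjOf {ι : Type*} [Countable ι] {n : ℕ} (f : ι → Form L n) : Form L n :=
  conj (Set.range (Countable.exists_injective_nat ι).choose) fun i => f i.2.choose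

theorem forall_conjOf_iff {ι : Type*} [Countable ι] {P : ι → Prop} :
    (∀ i : Set.range (Countable.exists_injective_nat ι).choose, P i.2.choose) ↔ ∀ i, P i := by
  refine ⟨fun h i => ?_, fun h i => h _⟩
  have hi := h ⟨_, i, rfl⟩
  rwa [(Countable.exists_injective_nat ι).choose_spec (Exists.choose_spec (⟨i, rfl⟩ : ∃ y,
    (Countable.exists_injective_nat ι).choose y = (Countable.exists_injective_nat ι).choose i))]
    at hi

theorem realize_conjOf {ι : Type*} [Countable ι] {M : Type*} [L.Structure M] {n : ℕ}
    (f : ι → Form L n) (a : Fin n → M) : (conjOf f).Realize a ↔ ∀ i, (f i).Realize a :=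
  forall_conjOf_iff (P := fun i => (f i).Realize a)

theorem isQF_conjOf {ι : Type*} [Countable ι] {n : ℕ} (f : ι → Form L n) :
    (conjOf f).IsQF ↔ ∀ i, (f i).IsQF :=
  forall_conjOf_iff (P := fun i => (f i).IsQF)

theorem mem_freeVars_conjOf {ι : Type*} [Countable ι] {n : ℕ} (f : ι → Form L n) (j : Fin n) :
    j ∈ (conjOf f).freeVars ↔ ∃ i, j ∈ (f i).freeVars := by
  have h := (forall_conjOf_iff (P := fun i => j ∉ (f i).freeVars)).not
  simp only [not_forall, not_not] at h
  exact h

/-- `φ` or `¬ φ`, whichever holds at `a`. -/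
def literal {M : Type*} [L.Structure M] {n : ℕ} (a : Fin n → M) (φ : Form L n)
    [Decidable (φ.Realize a)] : Form L n :=
  if φ.Realize a then φ else φ.neg

theorem realize_literal {M N : Type*} [L.Structure M] [L.Structure N] {n : ℕ} (a : Fin n → M)
    (φ : Form L n) [Decidable (φ.Realize a)] (b : Fin n → N) :
    (φ.literal a).Realize b ↔ (φ.Realize a ↔ φ.Realize b) := by
  unfold literal
  split_ifs with h
  · simp [h]
  · simp [h, Realize]

theorem isQF_literal {M : Type*} [L.Structure M] {n : ℕ} (a : Fin n → M)
    {φ : Form L n} [Decidable (φ.Realize a)] (h : φ.IsQF) : (φ.literal a).IsQF := by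
  unfold literal
  split_ifs <;> exact h

theorem freeVars_literal {M : Type*} [L.Structure M] {n : ℕ} (a : Fin n → M)
    (φ : Form L n) [Decidable (φ.Realize a)] : (φ.literal a).freeVars = φ.freeVars := by
  unfold literal
  split_ifs <;> rfl

/-- Indices of the atomic formulas in `n` variables. -/
abbrev AtomIndex (L : FirstOrder.Language.{u, v}) (n : ℕ) :=
  (L.Term (Fin n) × L.Term (Fin n)) ⊕ Σ R : (Σ l, L.Relations l), Fin R.1 → L.Term (Fin n)

/-- The atomic formula with a given index. -/
def atom {n : ℕ} : AtomIndex L n → Form L n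
  | .inl p => equal p.1 p.2
  | .inr p => rel p.1.2 p.2

theorem isQF_atom {n : ℕ} (i : AtomIndex L n) : (atom i).IsQF := by
  rcases i with p | p <;> trivial

theorem forall_atom_iff {M N : Type*} [L.Structure M] [L.Structure N] {n : ℕ} {a : Fin n → M}
    {b : Fin n → N} :
    (∀ i : AtomIndex L n, (atom i).Realize a ↔ (atom i).Realize b) ↔ AtomAgree L a b :=
  ⟨fun h => ⟨fun s t => h (.inl (s, t)), fun l R ts => h (.inr ⟨⟨l, R⟩, ts⟩)⟩,
    fun h i => h.realize_iff (isQF_atom i)⟩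

theorem countable_atomIndex [Countable L.Symbols] (n : ℕ) : Countable (AtomIndex L n) := by
  have : Countable (Σ l, L.Relations l) :=
    (Sum.inr_injective (α := Σ l, L.Functions l)).countable (β := L.Symbols)
  infer_instance

open Classical in
/-- The formula describing the quantifier-free type of `a`. -/
noncomputable def qftp [Countable L.Symbols] {M : Type*} [L.Structure M] {n : ℕ}
    (a : Fin n → M) : Form L n :=
  haveI := countable_atomIndex (L := L) n
  conjOf fun i : AtomIndex L n => (atom i).literal a

theorem realize_qftp [Countable L.Symbols] {M N : Type*} [L.Structure M] [L.Structure N] {n : ℕ}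
    (a : Fin n → M) (b : Fin n → N) : (qftp (L := L) a).Realize b ↔ AtomAgree L a b := by
  simp only [qftp, realize_conjOf, realize_literal, forall_atom_iff]

theorem isQFType_qftp [Countable L.Symbols] {M : Type w} [L.Structure M] [Nonempty M] {n : ℕ}
    (a : Fin n → M) : IsQFType.{u, v, w} (qftp (L := L) a) where
  isQF := by
    classical
    have := countable_atomIndex (L := L) n
    exact (isQF_conjOf _).2 fun i => isQF_literal a (isQF_atom i)
  freeVars_eq := by
    classical
    have := countable_atomIndex (L := L) n
    -- The literal on `x_j = x_j` makes every variable occur, whatever the language.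
    refine Set.eq_univ_of_forall fun j => (mem_freeVars_conjOf _ _).2
      ⟨.inl (Term.var j, Term.var j), ?_⟩
    rw [freeVars_literal]
    left
    simp
  satisfiable := ⟨M, _, ‹_›, fun _ h => h.elim, a, (realize_qftp a a).2 (.refl a)⟩
  complete φ hφ := by
    by_cases h : φ.Realize a
    · exact .inl fun N _ _ b hb => (((realize_qftp a b).1 hb).realize_iff hφ).1 h
    · exact .inr fun N _ _ b hb => mt (((realize_qftp a b).1 hb).realize_iff hφ).2 h

theorem nonRedundant_qftp [Countable L.Symbols] {M : Type w} [L.Structure M] {n : ℕ}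
    {a : Fin n → M} (ha : Function.Injective a) : NonRedundant.{u, v, w} (qftp (L := L) a) :=
  fun i j hij _ _ _ b hb h =>
    hij.ne (ha ((((realize_qftp a b).1 hb).eq_iff i j).2 h))

end Form

/-- Two realizations of one quantifier-free type satisfy the same atomic formulas. -/
theorem IsQFType.atomAgree {n : ℕ} {p : Form L n} (hp : IsQFType.{u, v, w} p) {M N : Type w}
    [L.Structure M] [L.Structure N] [Nonempty M] [Nonempty N] {a : Fin n → M} {b : Fin n → N}
    (ha : p.Realize a) (hb : p.Realize b) : AtomAgree L a b := by
  refine Form.forall_atom_iff.1 fun i => ?_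
  rcases hp.complete _ (Form.isQF_atom i) with h | h
  · exact iff_of_true (h M a ha) (h N b hb)
  · exact iff_of_false (h M a ha) (h N b hb)

end Basic

/-! ### Definability of orbits in countable structures -/

section Orbits

variable {L : FirstOrder.Language.{u, v}} {M : Type*} [L.Structure M]

/-- The tuples `a` and `b` satisfy the same formulas of `ℒ_{ω₁,ω}(L)`. -/
def FormEquiv (L : FirstOrder.Language.{u, v}) [L.Structure M] {n : ℕ} (a b : Fin n → M) : Prop :=
  ∀ φ : Form L n, φ.Realize a ↔ φ.Realize b

namespace FormEquiv

variable {n : ℕ} {a b : Fin n → M}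

theorem symm (h : FormEquiv L a b) : FormEquiv L b a := fun φ => (h φ).symm

theorem atomAgree (h : FormEquiv L a b) : AtomAgree L a b :=
  Form.forall_atom_iff.1 fun i => h (Form.atom i)

/-- Each `b` not equivalent to `a` is separated from it by one formula. As `M` has only countably
many `n`-tuples, the conjunction of these formulas, negated where necessary, is again a formula. -/
theorem exists_formula [Countable M] (a : Fin n → M) :
    ∃ φ : Form L n, ∀ b, φ.Realize b ↔ FormEquiv L a b := by
  classical
  have h : ∀ b : Fin n → M, ∃ φ : Form L n, (φ.Realize a ↔ φ.Realize b) → FormEquiv L a b := by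
    intro b
    by_contra! hb
    -- Any formula would do: `hb` at one formula already yields the failure of equivalence.
    exact (hb (.conj ∅ fun i => i.2.elim)).2 fun φ => (hb φ).1
  choose φ hφ using h
  refine ⟨Form.conjOf fun b => (φ b).literal a, fun b => ?_⟩
  simp only [Form.realize_conjOf, Form.realize_literal]
  exact ⟨fun h => hφ b (h b), fun h c => h _⟩

theorem forth [Countable M] (h : FormEquiv L a b) (c : M) :
    ∃ d, FormEquiv L (Fin.snoc a c : Fin (n + 1) → M) (Fin.snoc b d) := by
  obtain ⟨φ, hφ⟩ := exists_formula (L := L) (Fin.snoc a c : Fin (n + 1) → M)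
  obtain ⟨d, hd⟩ := (h φ.ex).1 ⟨c, (hφ _).2 fun _ => Iff.rfl⟩
  exact ⟨d, (hφ _).1 hd⟩

end FormEquiv

/-- Finite relations on `M` relating tuples that satisfy the same formulas of `ℒ_{ω₁,ω}(L)`. -/
abbrev PartialAut (L : FirstOrder.Language.{u, v}) (M : Type*) [L.Structure M] :=
  {Q : Set (M × M) // ∃ (n : ℕ) (f : Fin n → M × M), Set.range f = Q ∧
    FormEquiv L (Prod.fst ∘ f) (Prod.snd ∘ f)}

theorem PartialAut.isCofinal_dom [Countable M] (m : M) :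
    IsCofinal {Q : PartialAut L M | ∃ y, (m, y) ∈ Q.1} := by
  rintro ⟨_, n, f, rfl, h⟩
  obtain ⟨d, hd⟩ := h.forth m
  refine ⟨⟨_, n + 1, Fin.snoc f (m, d), rfl, ?_⟩, ⟨d, Fin.last n, by simp⟩, ?_⟩
  · rwa [Fin.comp_snoc, Fin.comp_snoc]
  · rintro _ ⟨i, rfl⟩
    exact ⟨i.castSucc, by simp⟩

theorem PartialAut.isCofinal_codom [Countable M] (m : M) :
    IsCofinal {Q : PartialAut L M | ∃ x, (x, m) ∈ Q.1} := by
  rintro ⟨_, n, f, rfl, h⟩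
  obtain ⟨d, hd⟩ := h.symm.forth m
  refine ⟨⟨_, n + 1, Fin.snoc f (d, m), rfl, ?_⟩, ⟨d, Fin.last n, by simp⟩, ?_⟩
  · rw [Fin.comp_snoc, Fin.comp_snoc]
    exact hd.symm
  · rintro _ ⟨i, rfl⟩
    exact ⟨i.castSucc, by simp⟩

/-- A monotone sequence of sets that covers finitely many points does so at some stage. -/
theorem exists_forall_mem_of_monotone {α β : Type*} [Finite β] {S : ℕ → Set α} (hS : Monotone S)
    {f : β → α} (h : ∀ i, ∃ k, f i ∈ S k) : ∃ k, ∀ i, f i ∈ S k := by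
  have := Fintype.ofFinite β
  choose k hk using h
  exact ⟨Finset.univ.sup k, fun i => hS (Finset.le_sup (Finset.mem_univ i)) (hk i)⟩

/-- In a countable structure, tuples satisfying the same formulas of `ℒ_{ω₁,ω}(L)` are conjugate. -/
theorem FormEquiv.exists_aut [Countable M] {n : ℕ} {a b : Fin n → M} (h : FormEquiv L a b) :
    ∃ g : L.Equiv M M, g ∘ a = b := by
  classical
  have := Encodable.ofCountable (M ⊕ M)
  let Q₀ : PartialAut L M := ⟨_, n, fun i => (a i, b i), rfl, h⟩
  -- Back and forth: the left summand puts each element into the domain, the right one into the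
  -- range. Starting at `Q₀` makes the limit send `a` to `b`.
  let D : M ⊕ M → Order.Cofinal (PartialAut L M) := Sum.elim
    (fun m => ⟨_, PartialAut.isCofinal_dom m⟩) (fun m => ⟨_, PartialAut.isCofinal_codom m⟩)
  let S := Order.sequenceOfCofinals Q₀ D
  have hS : Monotone fun k => (S k).1 := Order.sequenceOfCofinals.monotone Q₀ D
  have hmeet : ∀ i, S (Encodable.encode i + 1) ∈ D i :=
    Order.sequenceOfCofinals.encode_mem Q₀ D
  have hdom : ∀ m, ∃ y k, (m, y) ∈ (S k).1 := fun m =>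
    let ⟨y, hy⟩ := hmeet (.inl m)
    ⟨y, _, hy⟩
  have hcod : ∀ m, ∃ x k, (x, m) ∈ (S k).1 := fun m =>
    let ⟨y, hy⟩ := hmeet (.inr m)
    ⟨y, _, hy⟩
  have hagree : ∀ {β : Type} [Finite β] {f : β → M × M}, (∀ i, ∃ k, f i ∈ (S k).1) →
      AtomAgree L (fun i => (f i).1) (fun i => (f i).2) := by
    intro β _ f hf
    obtain ⟨k, hk⟩ := exists_forall_mem_of_monotone hS hf
    obtain ⟨m, t, ht, hQ⟩ := (S k).2
    rw [← ht] at hk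
    choose u hu using hk
    obtain rfl : t ∘ u = f := funext hu
    exact hQ.atomAgree.comp u
  have hiff : ∀ {x y x' y' : M}, (∃ k, (x, y) ∈ (S k).1) → (∃ k, (x', y') ∈ (S k).1) →
      (x = x' ↔ y = y') := by
    intro x y x' y' h₁ h₂
    refine (hagree (f := fun i : Bool => if i then (x, y) else (x', y')) ?_).eq_iff true false
    rintro (_ | _)
    exacts [h₂, h₁]
  choose g hg using hdom
  have hbij : Function.Bijective g := by
    refine ⟨fun x x' hx => (hiff (hg x) (hg x')).2 hx, fun y => ?_⟩
    obtain ⟨x, hx⟩ := hcod y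
    exact ⟨x, (hiff (hg x) hx).1 rfl⟩
  have hg' : ∀ {β : Type} [Finite β] (x : β → M), AtomAgree L x (g ∘ x) := fun x =>
    hagree (f := fun i => (x i, g (x i))) fun i => hg _
  refine ⟨⟨_root_.Equiv.ofBijective g hbij, fun {l} F x => ?_, fun {l} R x => ?_⟩, ?_⟩
  -- `none` stands for the value of `F` and `some i` for its arguments, so preservation of `F` is
  -- agreement on one equation.
  · exact ((hg' fun i : Option (Fin l) => i.elim (Structure.funMap F x) x).equal (Term.var none)
      (Term.func F fun i => Term.var (some i))).1 rfl
  · exact ((hg' x).rel l R fun i => Term.var i).symm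
  · funext i
    exact (hiff (hg (a i)) ⟨0, i, rfl⟩).1 rfl

/-- In a countable structure, the orbits of tuples are definable in `ℒ_{ω₁,ω}(L)`. -/
theorem exists_orbit_formula [Countable M] {n : ℕ} (a : Fin n → M) :
    ∃ φ : Form L n, ∀ b, φ.Realize b ↔ ∃ g : L.Equiv M M, g ∘ a = b := by
  obtain ⟨φ, hφ⟩ := FormEquiv.exists_formula (L := L) a
  refine ⟨φ, fun b => (hφ b).trans ⟨fun h => h.exists_aut, ?_⟩⟩
  rintro ⟨g, rfl⟩ ψ
  exact (Form.realize_equiv g ψ a).symm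

end Orbits

/-! ### Generic structures built from finite conditions, and forcing -/

section Generic

variable {L : FirstOrder.Language.{u, v}}

theorem AtomAgree.of_embedding {M N α : Type*} [L.Structure M] [L.Structure N]
    (g : L.Embedding M N) (a : α → M) : AtomAgree L a (g ∘ a) := by
  refine ⟨fun s t => ?_, fun l R ts => ?_⟩
  · simp only [HomClass.realize_term, g.injective.eq_iff]
  · simp only [HomClass.realize_term]
    exact (StrongHomClass.map_rel g R _).symm

/-- A tuple of elements of an ultraproduct satisfies the atomic formulas that hold eventually. -/
theorem AtomAgree.ultraproduct {ι α M N : Type*} [L.Structure M] [L.Structure N]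
    (U : Ultrafilter ι) {a : α → M} {b : α → ι → N} (h : ∀ᶠ k in (U : Filter ι), AtomAgree L a fun i => b i k) :
    AtomAgree L a fun i => (b i : (U : Filter ι).Product fun _ => N) := by
  refine ⟨fun s t => ?_, fun l R ts => ?_⟩
  · rw [Ultraproduct.term_realize_cast, Ultraproduct.term_realize_cast]
    refine Iff.trans ?_ Quotient.eq''.symm
    refine ⟨fun H => ?_, fun H => ?_⟩
    · filter_upwards [h] with k hk using (hk.equal s t).1 H
    · obtain ⟨k, hk, hk'⟩ := (h.and H).exists
      exact (hk.equal s t).2 hk'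
  · simp only [Ultraproduct.term_realize_cast]
    refine Iff.trans ?_ (relMap_quotient_mk' (s := (U : Filter ι).productSetoid fun _ => N) R
      fun i k => (ts i).realize fun j => b j k).symm
    refine ⟨fun H => ?_, fun H => ?_⟩
    · change ∀ᶠ k in (U : Filter ι), _
      filter_upwards [h] with k hk using (hk.rel l R ts).1 H
    · obtain ⟨k, hk, hk'⟩ := (h.and H).exists
      exact (hk.rel l R ts).2 hk'

/-- A finite piece of an assignment of elements of `M` to the variables indexed by `ℤ`. -/
structure Cond (L : FirstOrder.Language.{u, v}) (M : Type*) [L.Structure M] where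
  /-- The variables that are assigned. -/
  vars : Finset ℤ
  /-- The assignment, irrelevant outside `vars`. -/
  val : ℤ → M

namespace Cond

variable {M N : Type*} [L.Structure M] [L.Structure N]

/-- A stronger condition may change the values: only the quantifier-free type of the assigned
variables is kept. This is what allows a condition to be moved to a copy elsewhere in `M`. -/
instance : Preorder (Cond L M) where
  le p q := p.vars ⊆ q.vars ∧ AtomAgree L (fun i : p.vars => p.val i) (fun i : p.vars => q.val i)
  le_refl p := ⟨subset_rfl, .refl _⟩
  le_trans p q r h h' := ⟨h.1.trans h'.1, h.2.trans
    (h'.2.comp fun i : p.vars => (⟨i, h.1 i.2⟩ : q.vars))⟩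

/-- The tuple `e` satisfies the atomic formulas prescribed by `p`. -/
def Agree (p : Cond L M) (e : ℤ → N) : Prop :=
  AtomAgree L (fun i : p.vars => p.val i) (fun i : p.vars => e i)

theorem Agree.comp {p : Cond L M} {e : ℤ → N} (h : p.Agree e) {α : Type*} {x : α → ℤ}
    (hx : ∀ i, x i ∈ p.vars) : AtomAgree L (p.val ∘ x) (e ∘ x) :=
  AtomAgree.comp h fun i => (⟨x i, hx i⟩ : p.vars)

theorem Agree.eq_iff {p : Cond L M} {e : ℤ → N} (h : p.Agree e) {i j : ℤ} (hi : i ∈ p.vars)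
    (hj : j ∈ p.vars) : p.val i = p.val j ↔ e i = e j :=
  AtomAgree.eq_iff h ⟨i, hi⟩ ⟨j, hj⟩

theorem agree_of_le {p q : Cond L M} (h : p ≤ q) : p.Agree q.val := h.2

theorem isCofinal_mem_vars (i : ℤ) : IsCofinal {p : Cond L M | i ∈ p.vars} := fun p =>
  ⟨⟨insert i p.vars, p.val⟩, Finset.mem_insert_self _ _, Finset.subset_insert _ _, .refl _⟩

/-- The formula `ψ` holds at the tuple of variables `x` extended by some variable. -/
def HasWitness {n : ℕ} (ψ : Form L (n + 1)) (x : Fin n → ℤ) (p : Cond L M) : Prop :=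
  ∃ j : ℤ, (∀ i, (Fin.snoc x j : Fin (n + 1) → ℤ) i ∈ p.vars) ∧
    ψ.Realize (p.val ∘ (Fin.snoc x j : Fin (n + 1) → ℤ))

/-- A fresh variable is sent to a witness in `M`. Variables of `x` not yet assigned receive the
value that the total function `p.val` already has there. -/
theorem isCofinal_hasWitness {n : ℕ} {ψ : Form L (n + 1)}
    (hψ : ∀ a : Fin n → M, ψ.ex.Realize a) (x : Fin n → ℤ) :
    IsCofinal {p : Cond L M | p.HasWitness ψ x} := by
  intro p
  let t : Finset ℤ := p.vars ∪ Finset.univ.image x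
  obtain ⟨b, hb⟩ := hψ (p.val ∘ x)
  obtain ⟨j, hj⟩ := Infinite.exists_notMem_finset t
  have hval : ∀ i ∈ t, Function.update p.val j b i = p.val i := fun i hi =>
    Function.update_of_ne (ne_of_mem_of_not_mem hi hj) _ _
  refine ⟨⟨insert j t, Function.update p.val j b⟩, ⟨j, ?_, ?_⟩, ?_, ?_⟩
  · refine Fin.lastCases ?_ fun i => ?_
    · simp
    · simp [t]
  · rw [Fin.comp_snoc]
    convert hb using 2
    on_goal 2 => exact Function.update_self ..
    exact funext fun i => hval _ (by simp [t])
  · exact Finset.subset_union_left.trans (Finset.subset_insert _ _)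
  · have : (fun i : p.vars => Function.update p.val j b i) = fun i : p.vars => p.val i :=
      funext fun i => hval _ (Finset.mem_union_left _ i.2)
    change AtomAgree L _ fun i : p.vars => Function.update p.val j b i
    rw [this]
    exact .refl _

/-- The renaming of variables along a permutation. -/
def perm (π : ℤ ≃ ℤ) (p : Cond L M) : Cond L M := ⟨p.vars.map π.toEmbedding, p.val ∘ π.symm⟩

theorem perm_perm_symm (π : ℤ ≃ ℤ) (p : Cond L M) : (p.perm π.symm).perm π = p := by
  obtain ⟨s, a⟩ := p
  simp only [perm, mk.injEq]
  refine ⟨?_, ?_⟩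
  · ext i
    simp
  · ext i
    simp

theorem Agree.perm {p : Cond L M} {e : ℤ → N} (h : p.Agree e) (π : ℤ ≃ ℤ) :
    (p.perm π).Agree (e ∘ π.symm) :=
  AtomAgree.comp h fun i : (p.perm π).vars => (⟨π.symm i, by
    obtain ⟨j, hj, hji⟩ := Finset.mem_map.1 i.2
    rw [← hji]
    simpa using hj⟩ : p.vars)

theorem perm_mono (π : ℤ ≃ ℤ) : Monotone (perm π : Cond L M → Cond L M) := fun _ _ h =>
  ⟨Finset.map_subset_map.2 h.1, Agree.perm h.2 π⟩

/-- Requiring a sequence to meet these preimages makes the renamed sequence generic as well. -/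
theorem isCofinal_preimage_perm (π : ℤ ≃ ℤ) {D : Set (Cond L M)} (hD : IsCofinal D) :
    IsCofinal (perm π ⁻¹' D) := by
  intro p
  obtain ⟨q, hq, hpq⟩ := hD (p.perm π)
  refine ⟨q.perm π.symm, ?_, ?_⟩
  · rwa [Set.mem_preimage, perm_perm_symm]
  · have := perm_mono π.symm hpq
    rwa [show (p.perm π).perm π.symm = p from perm_perm_symm π.symm p] at this

end Cond

/-- The structure generated by an increasing sequence of conditions is enumerated by `e`. -/
structure IsLimit {M N : Type*} [L.Structure M] [L.Structure N] (p : ℕ → Cond L M)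
    (e : ℤ → N) : Prop where
  mono : Monotone p
  exhaust : ∀ i, ∃ k, i ∈ (p k).vars
  agree : ∀ k, (p k).Agree e
  surj : Function.Surjective e

namespace IsLimit

variable {M N : Type*} [L.Structure M] [L.Structure N] {p : ℕ → Cond L M} {e : ℤ → N}

theorem exists_forall_mem (h : IsLimit p e) {α : Type*} [Finite α] (x : α → ℤ) :
    ∃ k, ∀ i, x i ∈ (p k).vars :=
  exists_forall_mem_of_monotone (S := fun k => {i | i ∈ (p k).vars}) (fun _ _ hk => (h.mono hk).1)
    fun i => h.exhaust (x i)

theorem perm (h : IsLimit p e) (π : ℤ ≃ ℤ) : IsLimit (fun k => (p k).perm π) (e ∘ π.symm) where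
  mono := (Cond.perm_mono π).comp h.mono
  exhaust i := by
    obtain ⟨k, hk⟩ := h.exhaust (π.symm i)
    exact ⟨k, Finset.mem_map.2 ⟨_, hk, by simp⟩⟩
  agree k := (h.agree k).perm π
  surj := h.surj.comp π.symm.surjective

end IsLimit

/-- A form of the Rasiowa–Sikorski lemma. -/
theorem exists_generic_seq {P : Type*} [Preorder P] (p₀ : P) {𝒟 : Set (Set P)}
    (hc : 𝒟.Countable) (h𝒟 : ∀ D ∈ 𝒟, IsCofinal D) :
    ∃ p : ℕ → P, p 0 = p₀ ∧ Monotone p ∧ ∀ D ∈ 𝒟, ∃ k, p k ∈ D := by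
  have := hc.to_subtype
  have := Encodable.ofCountable 𝒟
  let F : 𝒟 → Order.Cofinal P := fun D => ⟨D.1, h𝒟 D.1 D.2⟩
  exact ⟨Order.sequenceOfCofinals p₀ F, rfl, Order.sequenceOfCofinals.monotone p₀ F,
    fun D hD => ⟨_, Order.sequenceOfCofinals.encode_mem p₀ F ⟨D, hD⟩⟩⟩

/-- Every sufficiently generic sequence of conditions from `M` generates a countable structure
satisfying a given countable family of `∀∃` properties of `M`. -/
theorem exists_limit [Countable L.Symbols] {M : Type w} [L.Structure M] {W : Type*} [Countable W]
    (k : W → ℕ) (ψ : ∀ i, Form L (k i + 1)) (hqf : ∀ i, (ψ i).IsQF)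
    (hψ : ∀ (i) (a : Fin (k i) → M), (ψ i).ex.Realize a) (p₀ : Cond L M)
    {𝒟 : Set (Set (Cond L M))} (hc : 𝒟.Countable) (h𝒟 : ∀ D ∈ 𝒟, IsCofinal D) :
    ∃ (N : Type w) (_ : L.Structure N) (p : ℕ → Cond L M) (e : ℤ → N),
      (∀ (i) (a : Fin (k i) → N), (ψ i).ex.Realize a) ∧ p 0 = p₀ ∧ IsLimit p e ∧
      ∀ D ∈ 𝒟, ∃ k, p k ∈ D := by
  classical
  -- Requiring witnesses for the graphs of the function symbols closes the set of enumerated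
  -- elements under the functions.
  let fn : (Σ l, L.Functions l) → Σ n, Form L (n + 1) := fun F =>
    ⟨F.1, .equal (Term.func F.2 fun i => Term.var i.castSucc) (Term.var (Fin.last _))⟩
  let 𝒲 : W ⊕ (Σ l, L.Functions l) → Σ n, Form L (n + 1) := Sum.elim (fun i => ⟨k i, ψ i⟩) fn
  have h𝒲 : ∀ i, (𝒲 i).2.IsQF := by
    rintro (i | i)
    exacts [hqf i, trivial]
  have h𝒲' : ∀ i (a : Fin (𝒲 i).1 → M), (𝒲 i).2.ex.Realize a := by
    rintro (i | i) a
    · exact hψ i a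
    · refine ⟨Structure.funMap i.2 a, ?_⟩
      change Structure.funMap i.2 (fun j => Fin.snoc (α := fun _ => M) a _ j.castSucc) =
        Fin.snoc (α := fun _ => M) a _ (Fin.last _)
      rw [Fin.snoc_last]
      exact congrArg _ (funext fun j => Fin.snoc_castSucc (α := fun _ => M) ..)
  let E : Set (Set (Cond L M)) := 𝒟 ∪ (Set.range (fun i : ℤ => {p : Cond L M | i ∈ p.vars}) ∪
    Set.range fun x : (Σ i, Fin (𝒲 i).1 → ℤ) => {p : Cond L M | p.HasWitness (𝒲 x.1).2 x.2})
  obtain ⟨p, hp₀, hp, hpE⟩ := exists_generic_seq p₀ (𝒟 := E)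
    (hc.union ((Set.countable_range _).union (Set.countable_range _))) (by
      rintro D (hD | ⟨i, rfl⟩ | ⟨x, rfl⟩)
      exacts [h𝒟 D hD, Cond.isCofinal_mem_vars i, Cond.isCofinal_hasWitness (h𝒲' x.1) x.2])
  -- The values of a variable in `M` need not stabilize, only the quantifier-free types do. The
  -- ultrapower supplies limit values, and the limit structure is the range of `e` in it.
  let U := Filter.hyperfilter ℕ
  let e : ℤ → (U : Filter ℕ).Product fun _ => M := fun i => ((fun k => (p k).val i : ℕ → M) :)
  have he : ∀ k, (p k).Agree e := fun k => by
    refine AtomAgree.ultraproduct U ?_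
    filter_upwards [Nat.hyperfilter_le_atTop (Filter.eventually_ge_atTop k)] with l hl
    exact Cond.agree_of_le (hp hl)
  have hwit : ∀ i (x : Fin (𝒲 i).1 → ℤ), ∃ j : ℤ,
      (𝒲 i).2.Realize (e ∘ (Fin.snoc x j : Fin ((𝒲 i).1 + 1) → ℤ)) := by
    intro i x
    obtain ⟨k, j, hj, h⟩ := hpE _ (.inr (.inr ⟨⟨i, x⟩, rfl⟩))
    exact ⟨j, (((he k).comp hj).realize_iff (h𝒲 i)).1 h⟩
  let S : L.Substructure ((U : Filter ℕ).Product fun _ => M) :=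
    { carrier := Set.range e
      fun_mem := fun {l} F x hx => by
        choose y hy using hx
        obtain rfl : e ∘ y = x := funext hy
        obtain ⟨j, hj⟩ := hwit (.inr ⟨l, F⟩) y
        refine ⟨j, ?_⟩
        simp only [𝒲, fn, Form.Realize, Fin.comp_snoc, Sum.elim_inr, Term.realize_func,
          Term.realize_var, Fin.snoc_castSucc, Fin.snoc_last] at hj
        exact hj.symm }
  let e' : ℤ → S := fun i => ⟨e i, i, rfl⟩
  have he' : AtomAgree L e' e := AtomAgree.of_embedding S.subtype e'
  have hsurj : Function.Surjective e' := by
    rintro ⟨_, i, rfl⟩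
    exact ⟨i, rfl⟩
  refine ⟨S, inferInstance, p, e', fun i a => ?_, hp₀, ⟨hp, fun i => ?_, fun k => ?_, hsurj⟩,
    fun D hD => hpE D (.inl hD)⟩
  · choose x hx using fun j => hsurj (a j)
    obtain rfl : e' ∘ x = a := funext hx
    obtain ⟨j, hj⟩ := hwit (.inl i) x
    refine ⟨e' j, ?_⟩
    rw [← Fin.comp_snoc]
    exact ((he'.comp _).realize_iff (hqf i)).2 hj
  · exact hpE _ (.inr (.inl ⟨i, rfl⟩))
  · exact (he k).trans (he'.symm.comp _)

/-- Every sufficiently generic sequence of conditions from a model of a countable pithy `Π₂` theory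
generates a countable model of it. -/
theorem exists_model_limit [Countable L.Symbols] {T : Set (Sentence L)} (hTc : T.Countable)
    (hTp : ∀ φ ∈ T, IsPithyPiTwo φ) {M : Type w} [L.Structure M] (hM : Models M T) (p₀ : Cond L M)
    {𝒟 : Set (Set (Cond L M))} (hc : 𝒟.Countable) (h𝒟 : ∀ D ∈ 𝒟, IsCofinal D) :
    ∃ (N : Type w) (_ : L.Structure N) (p : ℕ → Cond L M) (e : ℤ → N),
      Models N T ∧ p 0 = p₀ ∧ IsLimit p e ∧ ∀ D ∈ 𝒟, ∃ k, p k ∈ D := by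
  have := hTc.to_subtype
  choose k ψ hqf hψ using fun φ : T => hTp φ.1 φ.2
  obtain ⟨N, _, p, e, hN, h⟩ := exists_limit k ψ hqf (fun i => (Form.realize_alls _).1 (by
    rw [← hψ i]
    exact hM i.1 i.2)) p₀ hc h𝒟
  refine ⟨N, _, p, e, fun φ hφ => ?_, h⟩
  rw [show φ = _ from hψ ⟨φ, hφ⟩]
  exact (Form.realize_alls _).2 (hN ⟨φ, hφ⟩)

/-- Truth in structures generated by sufficiently generic sequences is decided by conditions. -/
theorem exists_forcing {M : Type*} [L.Structure M] {n : ℕ} (φ : Form L n) :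
    ∃ (F : (Fin n → ℤ) → Set (Cond L M)) (𝒟 : Set (Set (Cond L M))), 𝒟.Countable ∧
      (∀ D ∈ 𝒟, IsCofinal D) ∧ (∀ x, IsUpperSet (F x)) ∧
      ∀ (N : Type w) [L.Structure N] (p : ℕ → Cond L M) (e : ℤ → N), IsLimit p e →
        (∀ D ∈ 𝒟, ∃ k, p k ∈ D) → ∀ x, φ.Realize (e ∘ x) ↔ ∃ k, p k ∈ F x := by
  have base : ∀ {n : ℕ} (φ : Form L n), φ.IsQF →
    ∃ (F : (Fin n → ℤ) → Set (Cond L M)) (𝒟 : Set (Set (Cond L M))), 𝒟.Countable ∧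
      (∀ D ∈ 𝒟, IsCofinal D) ∧ (∀ x, IsUpperSet (F x)) ∧
      ∀ (N : Type w) [L.Structure N] (p : ℕ → Cond L M) (e : ℤ → N), IsLimit p e →
        (∀ D ∈ 𝒟, ∃ k, p k ∈ D) → ∀ x, φ.Realize (e ∘ x) ↔ ∃ k, p k ∈ F x := by
    intro n φ hφ
    refine ⟨fun x => {p | (∀ i, x i ∈ p.vars) ∧ φ.Realize (p.val ∘ x)}, ∅, Set.countable_empty,
      fun _ h => h.elim, fun x p q hpq hp => ⟨fun i => hpq.1 (hp.1 i), ?_⟩, ?_⟩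
    · exact (((Cond.agree_of_le hpq).comp hp.1).realize_iff hφ).1 hp.2
    · intro N _ p e h _ x
      refine ⟨fun hx => ?_, fun ⟨k, hk, hk'⟩ => (((h.agree k).comp hk).realize_iff hφ).1 hk'⟩
      obtain ⟨k, hk⟩ := h.exists_forall_mem x
      exact ⟨k, hk, (((h.agree k).comp hk).realize_iff hφ).2 hx⟩
  induction φ with
  | equal s t => exact base _ trivial
  | rel R ts => exact base _ trivial
  | neg φ ih =>
    obtain ⟨F, 𝒟, hc, h𝒟, hF, h⟩ := ih
    -- A negation is forced when no stronger condition forces the formula; the added dense sets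
    -- decide which case occurs.
    let G : (Fin _ → ℤ) → Set (Cond L M) := fun x => {p | ∀ q, p ≤ q → q ∉ F x}
    refine ⟨G, 𝒟 ∪ Set.range fun x => F x ∪ G x, hc.union (Set.countable_range _), ?_,
      fun x p q hpq hp r hr => hp r (hpq.trans hr), ?_⟩
    · rintro _ (hD | ⟨x, rfl⟩)
      · exact h𝒟 _ hD
      · intro p
        by_cases hp : p ∈ G x
        · exact ⟨p, .inr hp, le_rfl⟩
        · simp only [G, Set.mem_ofPred_eq, not_forall, not_not] at hp
          obtain ⟨q, hpq, hq⟩ := hp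
          exact ⟨q, .inl hq, hpq⟩
    · intro N _ p e hl hp x
      rw [Form.Realize, h N p e hl (fun D hD => hp D (.inl hD)) x]
      refine ⟨fun hx => ?_, fun ⟨k, hk⟩ ⟨l, hl'⟩ => ?_⟩
      · obtain ⟨k, hk | hk⟩ := hp _ (.inr ⟨x, rfl⟩)
        exacts [(hx ⟨k, hk⟩).elim, ⟨k, hk⟩]
      · exact hk _ (hl.mono (le_max_left k l)) (hF x (hl.mono (le_max_right k l)) hl')
  | conj I φ ih =>
    choose F 𝒟 hc h𝒟 hF h using ih
    let G : ∀ i, (Fin _ → ℤ) → Set (Cond L M) := fun i x => {p | ∀ q, p ≤ q → q ∉ F i x}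
    -- The conjuncts may become forced at unbounded stages, so the intersection of the `F i x` is
    -- too small. The conjunction is forced weakly: no stronger condition refutes a conjunct.
    let H : (Fin _ → ℤ) → Set (Cond L M) := fun x => {p | ∀ q, p ≤ q → ∀ i, q ∉ G i x}
    refine ⟨H, (⋃ i, 𝒟 i) ∪ ((Set.range fun x : I × _ => F x.1 x.2 ∪ G x.1 x.2) ∪
      Set.range fun x => H x ∪ ⋃ i, G i x), (Set.countable_iUnion hc).union
        ((Set.countable_range _).union (Set.countable_range _)), ?_,
      fun x p q hpq hp r hr => hp r (hpq.trans hr), ?_⟩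
    · rintro _ (hD | ⟨x, rfl⟩ | ⟨x, rfl⟩)
      · obtain ⟨i, hD⟩ := Set.mem_iUnion.1 hD
        exact h𝒟 i _ hD
      · intro p
        by_cases hp : p ∈ G x.1 x.2
        · exact ⟨p, .inr hp, le_rfl⟩
        · simp only [G, Set.mem_ofPred_eq, not_forall, not_not] at hp
          obtain ⟨q, hpq, hq⟩ := hp
          exact ⟨q, .inl hq, hpq⟩
      · intro p
        by_cases hp : p ∈ H x
        · exact ⟨p, .inl hp, le_rfl⟩
        · simp only [H, Set.mem_ofPred_eq, not_forall, not_not] at hp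
          obtain ⟨q, hpq, i, hq⟩ := hp
          exact ⟨q, .inr (Set.mem_iUnion.2 ⟨i, hq⟩), hpq⟩
    · intro N _ p e hl hp x
      have ih : ∀ i, (φ i).Realize (e ∘ x) ↔ ∃ k, p k ∈ F i x := fun i =>
        h i N p e hl (fun D hD => hp D (.inl (Set.mem_iUnion.2 ⟨i, hD⟩))) x
      refine ⟨fun hx => ?_, fun ⟨k, hk⟩ i => (ih i).2 ?_⟩
      · obtain ⟨k, hk | hk⟩ := hp _ (.inr (.inr ⟨x, rfl⟩))
        · exact ⟨k, hk⟩
        · obtain ⟨i, hk⟩ := Set.mem_iUnion.1 hk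
          obtain ⟨l, hl'⟩ := (ih i).1 (hx i)
          exact (hk _ (hl.mono (le_max_left k l)) (hF i x (hl.mono (le_max_right k l)) hl')).elim
      · obtain ⟨l, hl' | hl'⟩ := hp _ (.inr (.inl ⟨(i, x), rfl⟩))
        · exact ⟨l, hl'⟩
        · refine (hk _ (hl.mono (le_max_left k l)) i fun q hq => ?_).elim
          exact hl' q ((hl.mono (le_max_right k l)).trans hq)
  | ex φ ih =>
    obtain ⟨F, 𝒟, hc, h𝒟, hF, h⟩ := ih
    -- A union over variables suffices because every element of the limit is named by one.
    refine ⟨fun x => ⋃ j : ℤ, F (Fin.snoc x j), 𝒟, hc, h𝒟,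
      fun x => isUpperSet_iUnion fun j => hF _, ?_⟩
    intro N _ p e hl hp x
    have ih := h N p e hl hp
    constructor
    · rintro ⟨b, hb⟩
      obtain ⟨j, rfl⟩ := hl.surj b
      rw [← Fin.comp_snoc] at hb
      obtain ⟨k, hk⟩ := (ih _).1 hb
      exact ⟨k, Set.mem_iUnion.2 ⟨j, hk⟩⟩
    · rintro ⟨k, hk⟩
      obtain ⟨j, hk⟩ := Set.mem_iUnion.1 hk
      refine ⟨e j, ?_⟩
      rw [← Fin.comp_snoc]
      exact (ih _).2 ⟨k, hk⟩

end Generic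

/-! ### The two implications for the unique countable model -/

section UniqueModel

variable {L : FirstOrder.Language.{u, v}} [Countable L.Symbols] {T : Set (Sentence L)}
  {M : Type w} [L.Structure M]

/-- If `M` is the only countable model of `T`, the quantifier-free type of every finite tuple of a
model of `T` is realized in `M`. -/
theorem exists_atomAgree_of_unique (hTc : T.Countable) (hTp : ∀ φ ∈ T, IsPithyPiTwo φ)
    (huniq : ∀ (N : Type w) [L.Structure N] [Nonempty N] [Countable N],
      Models N T → Nonempty (L.Equiv N M))
    {N : Type w} [L.Structure N] [Nonempty N] (hN : Models N T) {n : ℕ} (c : Fin n → N) :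
    ∃ c' : Fin n → M, AtomAgree L c c' := by
  classical
  let ι : Fin n → ℤ := fun i => (i : ℕ)
  have hι : Function.Injective ι := fun i j h => Fin.ext (Nat.cast_injective h)
  -- A generic model above this condition realizes the quantifier-free type of `c` and, being
  -- countable, is a copy of `M`.
  let p₀ : Cond L N := ⟨Finset.univ.image ι, Function.extend ι c fun _ => Classical.arbitrary N⟩
  obtain ⟨K, _, p, e, hK, hp₀, hp, -⟩ := exists_model_limit hTc hTp hN p₀ (𝒟 := ∅)
    Set.countable_empty fun _ h => h.elim
  have : Nonempty K := ⟨e 0⟩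
  have : Countable K := hp.surj.countable
  obtain ⟨g⟩ := huniq K hK
  have h := hp.agree 0
  rw [hp₀] at h
  have h' := h.comp (x := ι) fun i => Finset.mem_image_of_mem _ (Finset.mem_univ i)
  rw [show p₀.val ∘ ι = c from
    funext fun i => hι.extend_apply c (fun _ => Classical.arbitrary N) i] at h'
  exact ⟨_, h'.trans (.of_equiv g _)⟩

theorem HasTrivialDcl.hasDuplication (hTc : T.Countable) (hTp : ∀ φ ∈ T, IsPithyPiTwo φ)
    [Nonempty M] (hM : Models M T)
    (huniq : ∀ (N : Type w) [L.Structure N] [Nonempty N] [Countable N],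
      Models N T → Nonempty (L.Equiv N M)) (h : HasTrivialDcl L M) :
    HasDuplication.{u, v, w} T := by
  rintro k p hp hnr ⟨N, _, _, hN, c₀, hc₀⟩
  obtain ⟨c, hc⟩ := exists_atomAgree_of_unique hTc hTp huniq hN c₀
  have hpc : p.Realize c := (hc.realize_iff hp.isQF).1 hc₀
  obtain ⟨b, z, rfl⟩ : ∃ b z, c = Fin.cons b z := ⟨c 0, Fin.tail c, (Fin.cons_self_tail c).symm⟩
  have hinj : Function.Injective (Fin.cons b z : Fin (k + 1) → M) := by
    intro i j hij
    by_contra hne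
    rcases lt_or_gt_of_ne hne with hlt | hlt
    · exact hnr i j hlt M _ hpc hij
    · exact hnr j i hlt M _ hpc hij.symm
  obtain ⟨hb, hz⟩ := Fin.cons_injective_iff.1 hinj
  have hdcl : b ∉ dcl L z := by rwa [h]
  simp only [dcl, Set.mem_ofPred_eq, not_forall] at hdcl
  obtain ⟨g, hg, hgb⟩ := hdcl
  have hgz : g ∘ (Fin.cons b z : Fin (k + 1) → M) = Fin.cons (g b) z := by
    funext i
    refine Fin.cases rfl hg i
  refine ⟨Form.qftp (Fin.cons b (Fin.cons (g b) z : Fin (k + 1) → M) : Fin (k + 2) → M),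
    Form.isQFType_qftp _, Form.nonRedundant_qftp ?_,
    ⟨M, _, ‹_›, hM, _, (Form.realize_qftp _ _).2 (.refl _)⟩, ?_⟩
  · rw [Fin.cons_injective_iff, ← hgz]
    refine ⟨?_, g.injective.comp hinj⟩
    rw [hgz]
    rintro ⟨i, hi⟩
    induction i using Fin.cases with
    | zero => exact hgb hi
    | succ i => exact hb ⟨i, hi⟩
  · intro K _ _ x y t hq
    have hq := (Form.realize_qftp _ _).1 hq
    refine ⟨?_, ?_⟩
    · have h₁ := hq.comp (Fin.cons 0 fun i => i.succ.succ : Fin (k + 1) → Fin (k + 2))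
      have aux : ∀ {P : Type w} (x y : P) (t : Fin k → P),
          (Fin.cons x (Fin.cons y t : Fin (k + 1) → P) : Fin (k + 2) → P) ∘
            (Fin.cons 0 fun i => i.succ.succ : Fin (k + 1) → Fin (k + 2)) = Fin.cons x t :=
        fun x y t => funext fun i => Fin.cases rfl (fun i => rfl) i
      rw [aux, aux] at h₁
      exact (h₁.realize_iff hp.isQF).1 hpc
    · have h₁ := hq.comp Fin.succ
      have h₂ := AtomAgree.of_equiv g (Fin.cons b z : Fin (k + 1) → M)
      rw [hgz] at h₂
      exact ((h₂.trans h₁).realize_iff hp.isQF).1 hpc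

/-- Duplication moves an element off itself over any finite set that does not contain it. -/
theorem HasDuplication.exists_maps (hTc : T.Countable) (hTp : ∀ φ ∈ T, IsPithyPiTwo φ)
    [Nonempty M] (hM : Models M T)
    (huniq : ∀ (N : Type w) [L.Structure N] [Nonempty N] [Countable N],
      Models N T → Nonempty (L.Equiv N M)) (h : HasDuplication.{u, v, w} T)
    {s : Finset M} {b : M} (hb : b ∉ s) :
    ∃ f g : M → M, (∀ m ∈ s, f m = g m) ∧ f b ≠ g b ∧
      AtomAgree L (fun i : {m // m = b ∨ m ∈ s} => i.1) (fun i => f i.1) ∧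
      AtomAgree L (fun i : {m // m = b ∨ m ∈ s} => i.1) (fun i => g i.1) := by
  let z : Fin s.card → M := fun i => s.equivFin.symm i
  let c : Fin (s.card + 1) → M := Fin.cons b z
  have hc : Function.Injective c := Fin.cons_injective_iff.2
    ⟨fun ⟨i, hi⟩ => hb (hi ▸ (s.equivFin.symm i).2),
      Subtype.val_injective.comp s.equivFin.symm.injective⟩
  have hcz : ∀ m ∈ s, ∃ i : Fin s.card, c i.succ = m := fun m hm =>
    ⟨s.equivFin ⟨m, hm⟩, by simp [c, z]⟩
  obtain ⟨q, hq, hqnr, ⟨N, _, _, hN, d₀, hd₀⟩, hqp⟩ := h s.card (Form.qftp c)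
    (Form.isQFType_qftp c) (Form.nonRedundant_qftp hc)
    ⟨M, _, ‹_›, hM, c, (Form.realize_qftp _ _).2 (.refl _)⟩
  obtain ⟨d, hd⟩ := exists_atomAgree_of_unique hTc hTp huniq hN d₀
  have hqd : q.Realize d := (hd.realize_iff hq.isQF).1 hd₀
  obtain ⟨x, y, t, rfl⟩ : ∃ x y t, d = Fin.cons x (Fin.cons y t : Fin (s.card + 1) → M) :=
    ⟨d 0, d 1, Fin.tail (Fin.tail d), by
      funext i
      refine Fin.cases rfl (fun i => Fin.cases rfl (fun i => rfl) i) i⟩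
  obtain ⟨hx, hy⟩ := hqp M x y t hqd
  rw [Form.realize_qftp] at hx hy
  -- `ρ` inverts the enumeration `c` of `b` and `s`. The maps below send this enumeration to `(x,
  -- t)` and `(y, t)`; their values elsewhere are irrelevant.
  let ρ : M → Fin (s.card + 1) := Function.invFun c
  have hρ : ∀ i, ρ (c i) = i := Function.leftInverse_invFun hc
  have hρ' : (fun i : {m // m = b ∨ m ∈ s} => c (ρ i.1)) = fun i => i.1 := by
    funext ⟨m, hm⟩
    obtain ⟨i, rfl⟩ : ∃ i, c i = m := by
      rcases hm with rfl | hm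
      · exact ⟨0, rfl⟩
      · obtain ⟨i, hi⟩ := hcz m hm
        exact ⟨_, hi⟩
    rw [hρ]
  refine ⟨fun m => (Fin.cons x t : Fin (s.card + 1) → M) (ρ m),
    fun m => (Fin.cons y t : Fin (s.card + 1) → M) (ρ m), fun m hm => ?_, ?_, ?_, ?_⟩
  · obtain ⟨i, rfl⟩ := hcz m hm
    simp only [hρ, Fin.cons_succ]
  · have hb0 : ρ b = 0 := hρ 0
    simp only [hb0, Fin.cons_zero]
    exact hqnr 0 1 (by simp) M _ hqd
  · rw [← hρ']
    exact hx.comp _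
  · rw [← hρ']
    exact hy.comp _

/-- Only finitely many differences of elements of `s` must be avoided. Indexing variables by `ℤ`
makes the translation a permutation. -/
theorem exists_add_notMem (s : Finset ℤ) : ∃ c : ℤ, ∀ i ∈ s, i + c ∉ s := by
  obtain ⟨c, hc⟩ := Infinite.exists_notMem_finset (Finset.image₂ (fun i j => i - j) s s)
  exact ⟨c, fun i hi hic => hc (Finset.mem_image₂.2 ⟨_, hic, i, hi, by ring⟩)⟩

/-- Duplication yields, above a condition, one condition containing two copies of it that differ at
the variables with a given value only. -/
theorem HasDuplication.exists_cond (hTc : T.Countable) (hTp : ∀ φ ∈ T, IsPithyPiTwo φ)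
    [Nonempty M] (hM : Models M T)
    (huniq : ∀ (N : Type w) [L.Structure N] [Nonempty N] [Countable N],
      Models N T → Nonempty (L.Equiv N M)) (h : HasDuplication.{u, v, w} T)
    (p : Cond L M) (b : M) :
    ∃ (q : Cond L M) (π : ℤ ≃ ℤ), p ≤ q ∧ p ≤ q.perm π ∧ ∀ i ∈ p.vars, π.symm i ∈ q.vars ∧
      (q.val i = q.val (π.symm i) ↔ p.val i ≠ b) := by
  classical
  obtain ⟨f, g, hfg, hb, hf, hg⟩ := h.exists_maps hTc hTp hM huniq
    (Finset.notMem_erase b (p.vars.image p.val))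
  obtain ⟨c, hc⟩ := exists_add_notMem p.vars
  -- One copy of `p` sits on the original variables, through `f`, and one on their translates,
  -- through `g`; `hc` keeps the two sets of variables disjoint.
  let q : Cond L M := ⟨p.vars ∪ p.vars.image (· + c),
    fun i => if i ∈ p.vars then f (p.val i) else g (p.val (i - c))⟩
  let ι : p.vars → {m // m = b ∨ m ∈ (p.vars.image p.val).erase b} := fun i => ⟨p.val i, by
    by_cases hi : p.val i = b
    · exact .inl hi
    · exact .inr (Finset.mem_erase.2 ⟨hi, Finset.mem_image_of_mem _ i.2⟩)⟩
  have hq₁ : ∀ i ∈ p.vars, q.val i = f (p.val i) := fun i hi => if_pos hi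
  have hq₂ : ∀ i ∈ p.vars, q.val (i + c) = g (p.val i) := fun i hi => by
    simp [q, hc i hi]
  have hmem : ∀ i ∈ p.vars, i + c ∈ q.vars := fun i hi =>
    Finset.mem_union_right _ (Finset.mem_image_of_mem _ hi)
  -- The renaming is translation by `-c`, so it moves the second copy onto the original variables.
  refine ⟨q, (_root_.Equiv.addRight c).symm, ⟨Finset.subset_union_left, ?_⟩,
    ⟨fun i hi => Finset.mem_map.2 ⟨i + c, hmem i hi, by simp⟩, ?_⟩, fun i hi => ⟨hmem i hi, ?_⟩⟩
  · rw [show (fun i : p.vars => q.val i) = fun i : p.vars => f (p.val i) from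
      funext fun i => hq₁ i i.2]
    exact hf.comp ι
  · change AtomAgree L _ fun i : p.vars => q.val (i + c)
    rw [show (fun i : p.vars => q.val (i + c)) = fun i : p.vars => g (p.val i) from
      funext fun i => hq₂ i i.2]
    exact hg.comp ι
  · change q.val i = q.val (i + c) ↔ _
    rw [hq₁ i hi, hq₂ i hi]
    refine ⟨fun h h' => hb (h' ▸ h), fun h => hfg _ ?_⟩
    exact Finset.mem_erase.2 ⟨h, Finset.mem_image_of_mem _ hi⟩

theorem HasDuplication.hasTrivialDcl (hTc : T.Countable) (hTp : ∀ φ ∈ T, IsPithyPiTwo φ)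
    [Nonempty M] [Countable M] (hM : Models M T)
    (huniq : ∀ (N : Type w) [L.Structure N] [Nonempty N] [Countable N],
      Models N T → Nonempty (L.Equiv N M)) (h : HasDuplication.{u, v, w} T) :
    HasTrivialDcl L M := by
  intro n a
  refine Set.Subset.antisymm (fun b hb => ?_) ?_
  swap
  · rintro _ ⟨i, rfl⟩ g hg
    exact hg i
  by_contra hba
  obtain ⟨φ, hφ⟩ := exists_orbit_formula (L := L) (Fin.snoc a b : Fin (n + 1) → M)
  obtain ⟨F, 𝒟, hc, h𝒟, hF, hforce⟩ := exists_forcing.{u, v, w} (M := M) φ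
  obtain ⟨p, x, hpF, hpx, hpb⟩ : ∃ (p : Cond L M) (x : Fin (n + 1) → ℤ), p ∈ F x ∧
      (∀ i, x i ∈ p.vars) ∧ ∀ i : Fin n, p.val (x i.castSucc) ≠ p.val (x (Fin.last n)) := by
    obtain ⟨N, _, p, e, hN, -, hp, hgen⟩ := exists_model_limit hTc hTp hM ⟨∅, fun _ => b⟩ hc h𝒟
    have : Nonempty N := ⟨e 0⟩
    have : Countable N := hp.surj.countable
    obtain ⟨g⟩ := huniq N hN
    choose x hx using fun i => hp.surj (g.symm ((Fin.snoc a b : Fin (n + 1) → M) i))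
    have hx' : e ∘ x = g.symm ∘ (Fin.snoc a b : Fin (n + 1) → M) := funext hx
    have hφx : φ.Realize (e ∘ x) := by
      rw [hx', Form.realize_equiv, hφ]
      exact ⟨.refl L M, rfl⟩
    obtain ⟨k, hk⟩ := (hforce N p e hp hgen x).1 hφx
    obtain ⟨l, hl⟩ := hp.exists_forall_mem x
    have hmem : ∀ i, x i ∈ (p (max k l)).vars := fun i => (hp.mono (le_max_right k l)).1 (hl i)
    -- Stage `k` forces `φ`, and stage `l` has assigned all the variables `x`.
    refine ⟨p (max k l), x, hF x (hp.mono (le_max_left k l)) hk, hmem, fun i hi => hba ⟨i, ?_⟩⟩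
    have := ((hp.agree _).eq_iff (hmem _) (hmem _)).1 hi
    rw [hx, hx, g.symm.injective.eq_iff, Fin.snoc_castSucc, Fin.snoc_last] at this
    exact this
  obtain ⟨q, π, hq₁, hq₂, hq⟩ := h.exists_cond hTc hTp hM huniq p (p.val (x (Fin.last n)))
  -- The sequence is generic both as it stands and after renaming by `π`, so forcing applies to the
  -- enumerations `e` and `e ∘ π.symm` of one structure.
  obtain ⟨N, _, r, e, hN, hr₀, hr, hgen⟩ := exists_model_limit hTc hTp hM q
    (𝒟 := 𝒟 ∪ Set.preimage (Cond.perm π) '' 𝒟) (hc.union (hc.image _)) (by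
      rintro _ (hD | ⟨D, hD, rfl⟩)
      exacts [h𝒟 _ hD, Cond.isCofinal_preimage_perm π (h𝒟 D hD)])
  have : Nonempty N := ⟨e 0⟩
  have : Countable N := hr.surj.countable
  obtain ⟨g⟩ := huniq N hN
  have h₁ : φ.Realize (e ∘ x) := (hforce N r e hr (fun D hD => hgen D (.inl hD)) x).2
    ⟨0, hr₀ ▸ hF x hq₁ hpF⟩
  have h₂ : φ.Realize ((e ∘ π.symm) ∘ x) :=
    (hforce N _ _ (hr.perm π) (fun D hD => hgen _ (.inr ⟨D, hD, rfl⟩)) x).2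
      ⟨0, hr₀ ▸ hF x hq₂ hpF⟩
  rw [← Form.realize_equiv g, hφ] at h₁ h₂
  obtain ⟨g₁, hg₁⟩ := h₁
  obtain ⟨g₂, hg₂⟩ := h₂
  have hiff : ∀ i, g₁ ((Fin.snoc a b : Fin (n + 1) → M) i) =
      g₂ ((Fin.snoc a b : Fin (n + 1) → M) i) ↔ p.val (x i) ≠ p.val (x (Fin.last n)) := by
    intro i
    have hagree := hr.agree 0
    rw [hr₀] at hagree
    have e₁ := congrFun hg₁ i
    have e₂ := congrFun hg₂ i
    simp only [Function.comp_apply] at e₁ e₂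
    rw [e₁, e₂, g.injective.eq_iff, ← (hq (x i) (hpx i)).2]
    exact (hagree.eq_iff (hq₁.1 (hpx i)) (hq (x i) (hpx i)).1).symm
  -- The two tuples agree on `a`, so `g₂⁻¹ g₁` fixes `a` and hence `b`; but they differ at `b`.
  have hfix := hb (g₂.symm.comp g₁) fun i => by
    have := (hiff i.castSucc).2 (hpb i)
    rw [Fin.snoc_castSucc] at this
    rw [FirstOrder.Language.Equiv.comp_apply, this, FirstOrder.Language.Equiv.symm_apply_apply]
  refine (hiff (Fin.last n)).1 ?_ rfl
  rw [Fin.snoc_last]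
  rw [FirstOrder.Language.Equiv.comp_apply] at hfix
  rw [← g₂.apply_symm_apply (g₁ b), hfix]

end UniqueModel

end Infinitary

theorem mainTheorem7 (L : FirstOrder.Language.{u, v}) [Countable L.Symbols]
    (T : Set (Infinitary.Sentence L)) (hTc : T.Countable)
    (hTp : ∀ φ ∈ T, Infinitary.IsPithyPiTwo φ)
    (M : Type w) [L.Structure M] [Nonempty M] [Countable M]
    (hM : Infinitary.Models M T)
    (huniq : ∀ (N : Type w) [L.Structure N] [Nonempty N] [Countable N],
      Infinitary.Models N T → Nonempty (L.Equiv N M)) :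
    Infinitary.HasTrivialDcl L M ↔ Infinitary.HasDuplication.{u, v, w} T :=
  ⟨fun h => h.hasDuplication hTc hTp hM huniq, fun h => h.hasTrivialDcl hTc hTp hM huniq⟩
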